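/- **Setting.** A signed graph $G_\phi$ is a finite simple graph $G=(V,E)$ with a sign function $\phi:E\to\{+1,-1\}$. *Switching* a vertex $v$ reverses the sign of every edge incident to $v$; $G_\phi$ is *balanced* if a finite sequence of switchings turns it into the all-positive signed graph on $G$, and *unbalanced* otherwise. The signed Laplacian of $G_\phi$ is the $V\times V$ matrix with diagonal entries $\deg(v)$, entry $-\phi(\{u,v\})$ at $(u,v)$ if $\{u,v\}\in E$, and entry $0$ at the other off-diagonal positions. If $q\in V$ is chosen as sink, the reduced Laplacian $L$ is obtained by deleting the row and column of $q$, and the critical group is $\mathcal K(G_\phi)=\mathbb Z^{V\setminus\{q\}}/\operatorname{im}L$. For $n\ge 3$ the wheel $W_n$ is the graph on $n+1$ vertices obtained by joining a vertex $q$, the sink, to all vertices of an $n$-cycle; its rim $W_n\setminus q$ is that $n$-cycle. For a signed wheel $(W_n)_\phi$, with arbitrary signs on all $2n$ edges, let $(W_n)_\phi\setminus q$ be the signed $n$-cycle obtained by deleting $q$ together with the edges incident to it. Let $f_0=0$, $f_1=1$, $f_n=f_{n-1}+f_{n-2}$ be the Fibonacci numbers and $\ell_0=2$, $\ell_1=1$,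 $\ell_n=\ell_{n-1}+\ell_{n-2}$ the Lucas numbers, and write $\mathbb Z_k=\mathbb Z/k\mathbb Z$. **Theorem.** Let $n\ge 3$. For every signed wheel $(W_n)_\phi$, $$\mathcal K((W_n)_\phi)\cong\begin{cases} \mathbb Z_{f_n}\oplus\mathbb Z_{5f_n}, & n \text{ odd and } (W_n)_\phi\setminus q \text{ unbalanced},\\ \mathbb Z_{\ell_n}\oplus\mathbb Z_{\ell_n}, & n \text{ even and } (W_n)_\phi\setminus q \text{ unbalanced},\\ \mathbb Z_{\ell_n}\oplus\mathbb Z_{\ell_n}, & n \text{ odd and } (W_n)_\phi\setminus q \text{ balanced},\\ \mathbb Z_{f_n}\oplus\mathbb Z_{5f_n}, & n \text{ even and } (W_n)_\phi\setminus q \text{ balanced}. \end{cases}$$ Moreover, these are exactly the critical groups that occur: for every $n\ge 3$, an abelian group is isomorphic to $\mathcal K((W_n)_\phi)$ for some sign function $\phi$ if and only if it is isomorphic to $\mathbb Z_{f_n}\oplus\mathbb Z_{5f_n}$ or to $\mathbb Z_{\ell_n}\oplus\mathbb Z_{\ell_n}$. -/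

import Mathlib

namespace SignedGraph

/-- A sign function on the edges of a simple graph `G`; the two signs are the units `1` and `-1`
of `ℤ`. A signed graph is a simple graph together with such a function. -/
abbrev Signature {V : Type*} (G : SimpleGraph V) : Type _ := G.edgeSet → ℤˣ

section General

variable {V : Type*} [DecidableEq V] {G : SimpleGraph V}

/-- The signed graph obtained by switching the vertex `v`: the sign of every edge incident to `v`
is reversed. -/
def switch (φ : Signature G) (v : V) : Signature G :=
  fun e => if v ∈ e.1 then -φ e else φ e

/-- Two signatures of `G` are switching equivalent if a finite sequence of vertex switchings takes
one to the other. -/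
def SwitchingEquivalent (φ ψ : Signature G) : Prop :=
  Relation.ReflTransGen (fun α β : Signature G => ∃ v : V, β = switch α v) φ ψ

/-- A signed graph is balanced if it is switching equivalent to the all-positive one. -/
def IsBalanced (φ : Signature G) : Prop :=
  SwitchingEquivalent φ (fun _ => 1)

/-- The signed graph obtained by deleting the vertex `q` and all edges incident to it, every other
edge keeping its sign. -/
def deleteVertex (φ : Signature G) (q : V) : Signature (G.induce {v | v ≠ q}) :=
  fun e => φ ⟨e.1.map Subtype.val, by
    rcases e with ⟨e, he⟩
    induction e using Sym2.ind with
    | _ a b => exact he⟩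

/-- The signed Laplacian: vertex degrees on the diagonal, `-1` at a positive edge, `1` at a
negative edge, and `0` elsewhere. -/
def laplacian [Fintype V] [DecidableRel G.Adj] (φ : Signature G) : Matrix V V ℤ :=
  Matrix.of fun i j =>
    if i = j then (G.degree i : ℤ)
    else if h : G.Adj i j then -((φ ⟨s(i, j), h⟩ : ℤˣ) : ℤ)
    else 0

/-- The reduced signed Laplacian with respect to the sink `q`: the row and the column of `q` are
removed. -/
def reducedLaplacian [Fintype V] [DecidableRel G.Adj] (φ : Signature G) (q : V) :
    Matrix {v : V // v ≠ q} {v : V // v ≠ q} ℤ :=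
  (laplacian φ).submatrix Subtype.val Subtype.val

/-- The critical group of a signed graph with sink `q`: the cokernel of the reduced signed
Laplacian, acting on integer configurations on the nonsink vertices. -/
abbrev CriticalGroup [Fintype V] [DecidableRel G.Adj] (φ : Signature G) (q : V) : Type _ :=
  ({v : V // v ≠ q} → ℤ) ⧸ LinearMap.range (reducedLaplacian φ q).mulVecLin

end General

/-- The wheel graph: the hub `none` is joined to every vertex `some i` of the cycle on `Fin n`. -/
def wheelGraph (n : ℕ) : SimpleGraph (Option (Fin n)) where
  Adj
    | none, none => False
    | none, some _ => True
    | some _, none => True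
    | some i, some j => (SimpleGraph.cycleGraph n).Adj i j
  symm := ⟨by
    rintro (_ | i) (_ | j) h
    · exact h
    · trivial
    · trivial
    · exact SimpleGraph.Adj.symm h⟩
  loopless := ⟨by
    rintro (_ | i) h
    · exact h
    · exact (SimpleGraph.cycleGraph n).loopless.irrefl i h⟩

instance (n : ℕ) : DecidableRel (wheelGraph n).Adj
  | none, none => isFalse id
  | none, some _ => isTrue trivial
  | some _, none => isTrue trivial
  | some i, some j => inferInstanceAs (Decidable ((SimpleGraph.cycleGraph n).Adj i j))

/-- The Lucas numbers `2, 1, 3, 4, 7, …`. -/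
def lucas : ℕ → ℕ
  | 0 => 2
  | 1 => 1
  | n + 2 => lucas (n + 1) + lucas n

end SignedGraph

/-!
Write `θ` for the golden ratio, so that `t = θ²` satisfies `t² = 3 t - 1`, and let `ε` be the product
of the signs of the rim edges. All nonsink vertices have degree `3`, so the column of the reduced
Laplacian at a rim vertex says that, after switching, three times its class is the sum of the
classes of its two neighbours. Hence the critical group is `ℤ[t] / (t² - 3 t + 1, tⁿ - ε)`, which is
`ℤ[θ] / (θ²ⁿ - ε)`. Up to the unit `θⁿ`, the element `θ²ⁿ - ε` is `θⁿ - ε θ⁻ⁿ`, which is `√5 f_n` if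
`ε = (-1)ⁿ` and `ℓ_n` if `ε = -(-1)ⁿ`. The quotients are `ℤ / f_n × ℤ / 5 f_n` and `(ℤ / ℓ_n)²`.

The ring `ℤ[θ]` is avoided by speaking of Fibonacci sequences `K` in abelian groups: such a sequence
stands for an additive homomorphism from `ℤ[θ]`, with `K i` the image of `θⁱ`. A homomorphism from
`ℤ[θ] / (θ²ⁿ - ε)` is then a Fibonacci sequence with `K (i + 2 n) = ε K i`. The signed classes of the
rim vertices are the even-indexed terms of such a sequence (`exists_fibSeq_criticalGroup`), and the
critical group is therefore isomorphic to any group that carries a universal one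
(`nonempty_criticalGroup_equiv`). The two factorizations are `IsFibSeq.sub_neg_one_pow_smul` and
`IsFibSeq.add_neg_one_pow_smul`; they show that `ℤ / f_n × ℤ / 5 f_n` and `(ℤ / ℓ_n)²` carry
universal sequences (`exists_universal_fib`, `exists_universal_lucas`).

The rim is balanced exactly when `ε = 1` (`isBalanced_deleteVertex_iff`): a switching changes the
signs of an even number of rim edges, and if `ε = 1` the partial products of the signs around the rim
form a potential. Both values of `ε` occur, so both groups occur for every `n`.
-/

/-! ### Fibonacci sequences in abelian groups -/

namespace SignedGraph

/-- A sequence in an abelian group that satisfies the Fibonacci recurrence. -/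
def IsFibSeq {A : Type*} [AddCommGroup A] (K : ℕ → A) : Prop :=
  ∀ i, K (i + 2) = K (i + 1) + K i

namespace IsFibSeq

variable {A : Type*} [AddCommGroup A] {K K' : ℕ → A}

/-- The recurrence runs backwards as well, so a Fibonacci sequence can be prescribed at any two
consecutive positions. -/
theorem exists_of_consecutive (N : ℕ) (u v : A) :
    ∃ K : ℕ → A, IsFibSeq K ∧ K N = u ∧ K (N + 1) = v := by
  induction N generalizing u v with
  | zero =>
    let step : A × A → A × A := fun x => (x.2, x.2 + x.1)
    refine ⟨fun i => (step^[i] (u, v)).1, fun i => ?_, rfl, rfl⟩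
    simp [step, Function.iterate_succ_apply']
  | succ N ih =>
    obtain ⟨K, hK, h0, h1⟩ := ih (v - u) u
    exact ⟨K, hK, h1, by rw [hK, h0, h1]; abel⟩

theorem ext_of_consecutive (hK : IsFibSeq K) (hK' : IsFibSeq K') (N : ℕ) (h0 : K N = K' N)
    (h1 : K (N + 1) = K' (N + 1)) : K = K' := by
  have start : K 0 = K' 0 ∧ K 1 = K' 1 := by
    induction N with
    | zero => exact ⟨h0, h1⟩
    | succ N ih =>
      refine ih ?_ h0
      have := hK N
      rw [h1, h0, hK' N] at this
      exact (add_left_cancel this).symm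
  have both : ∀ i, K i = K' i ∧ K (i + 1) = K' (i + 1) := by
    intro i
    induction i with
    | zero => exact start
    | succ i ih => exact ⟨ih.2, by rw [hK, hK', ih.1, ih.2]⟩
  exact funext fun i => (both i).1

theorem shift (hK : IsFibSeq K) (d : ℕ) : IsFibSeq fun i => K (i + d) := fun i => by
  have := hK (i + d)
  simp only [show i + 2 + d = i + d + 2 by ring, show i + 1 + d = i + d + 1 by ring]
  exact this

theorem smul (hK : IsFibSeq K) (c : ℤ) : IsFibSeq fun i => c • K i := fun i => by
  simp only [hK i, smul_add]

theorem map {B : Type*} [AddCommGroup B] (hK : IsFibSeq K) (g : A →+ B) :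
    IsFibSeq fun i => g (K i) := fun i => by
  simp only [hK i, map_add]

/-- Passing from `K` to `i ↦ 2 K (i + 1) - K i` plays the role of multiplication by `√5 = 2 θ - 1`. -/
theorem two_smul_sub (hK : IsFibSeq K) : IsFibSeq fun i => (2 : ℤ) • K (i + 1) - K i := fun i => by
  simp only [hK (i + 1), hK i]
  module

theorem apply_add (hK : IsFibSeq K) (p m : ℕ) :
    K (p + m) = ((Nat.fib (m + 1) : ℤ) - Nat.fib m) • K p + (Nat.fib m : ℤ) • K (p + 1) ∧
    K (p + m + 1) = (Nat.fib m : ℤ) • K p + (Nat.fib (m + 1) : ℤ) • K (p + 1) := by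
  induction m with
  | zero => simp
  | succ m ih =>
    rw [Nat.fib_add_two]
    push_cast
    refine ⟨?_, ?_⟩
    · rw [← add_assoc, ih.2]; module
    · rw [show p + (m + 1) + 1 = p + m + 2 by ring, hK, ih.1, ih.2]; module

/-- Up to sign, `K p` in terms of two consecutive later values; this is the analogue of dividing by
`θ ^ m`. -/
theorem neg_one_pow_smul (hK : IsFibSeq K) (p m : ℕ) :
    ((-1) ^ m : ℤ) • K p =
      (Nat.fib (m + 1) : ℤ) • K (p + m) - (Nat.fib m : ℤ) • K (p + m + 1) := by
  induction m with
  | zero => simp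
  | succ m ih =>
    rw [pow_succ, mul_comm, mul_smul, ih, ← add_assoc, hK (p + m), Nat.fib_add_two]
    push_cast
    module

end IsFibSeq

theorem lucas_cast (m : ℕ) : (lucas m : ℤ) = 2 * Nat.fib (m + 1) - Nat.fib m := by
  induction m using Nat.twoStepInduction with
  | zero => simp [lucas]
  | one => simp [lucas]
  | more m h0 h1 =>
    rw [lucas, Nat.cast_add, h0, h1, Nat.fib_add_two (n := m + 1), Nat.fib_add_two (n := m)]
    push_cast
    ring

namespace IsFibSeq

variable {A : Type*} [AddCommGroup A] {K : ℕ → A}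

/-- The analogue of `θ ^ (2 m) + (-1) ^ m = ℓ_m θ ^ m` for the golden ratio `θ`. -/
theorem add_neg_one_pow_smul (hK : IsFibSeq K) (p m : ℕ) :
    K (p + 2 * m) + ((-1) ^ m : ℤ) • K p = (lucas m : ℤ) • K (p + m) := by
  rw [hK.neg_one_pow_smul, two_mul, ← add_assoc, (hK.apply_add (p + m) m).1, lucas_cast]
  module

/-- The analogue of `θ ^ (2 m) - (-1) ^ m = √5 f_m θ ^ m` for the golden ratio `θ`. -/
theorem sub_neg_one_pow_smul (hK : IsFibSeq K) (p m : ℕ) :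
    K (p + 2 * m) - ((-1) ^ m : ℤ) • K p =
      (Nat.fib m : ℤ) • ((2 : ℤ) • K (p + m + 1) - K (p + m)) := by
  rw [hK.neg_one_pow_smul, two_mul, ← add_assoc, (hK.apply_add (p + m) m).1]
  module

end IsFibSeq

/-! ### Universal Fibonacci sequences with a prescribed multiplier -/

theorem exists_hom_zmod_prod {Q : Type*} [AddCommGroup Q] {a b : ℕ} {x y : Q}
    (hx : (a : ℤ) • x = 0) (hy : (b : ℤ) • y = 0) :
    ∃ g : ZMod a × ZMod b →+ Q, g (1, 0) = x ∧ g (0, 1) = y := by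
  refine ⟨(ZMod.lift a ⟨zmultiplesHom Q x, by simpa using hx⟩).coprod
    (ZMod.lift b ⟨zmultiplesHom Q y, by simpa using hy⟩), ?_, ?_⟩
  · have := ZMod.lift_coe a ⟨zmultiplesHom Q x, by simpa using hx⟩ 1
    simpa using this
  · have := ZMod.lift_coe b ⟨zmultiplesHom Q y, by simpa using hy⟩ 1
    simpa using this

theorem zmod_prod_eq_zsmul {a b : ℕ} (z : ZMod a × ZMod b) :
    ∃ s t : ℤ, z = s • ((1, 0) : ZMod a × ZMod b) + t • ((0, 1) : ZMod a × ZMod b) := by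
  obtain ⟨s, hs⟩ := ZMod.intCast_surjective z.1
  obtain ⟨t, ht⟩ := ZMod.intCast_surjective z.2
  exact ⟨s, t, by ext <;> simp [hs, ht]⟩

/-- `K` is a Fibonacci sequence with `K (i + 2 * n) = ε * K i` whose values generate `G`, and every
such sequence in `Q` is the image of `K` under a homomorphism. The test group `Q` is a parameter, so
that no universe is quantified over. -/
structure IsUniversalFibSeq {G : Type*} [AddCommGroup G] (n : ℕ) (ε : ℤ) (K : ℕ → G)
    (Q : Type*) [AddCommGroup Q] : Prop where
  isFibSeq : IsFibSeq K
  period : ∀ i, K (i + 2 * n) = ε • K i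
  closure_range : AddSubgroup.closure (Set.range K) = ⊤
  exists_hom : ∀ k : ℕ → Q, IsFibSeq k → (∀ i, k (i + 2 * n) = ε • k i) →
    ∃ g : G →+ Q, ∀ i, g (K i) = k i

/-- The analogue of `ℤ[θ] / (ℓ_n) = (ℤ / ℓ_n)²`. -/
theorem exists_universal_lucas (n : ℕ) (Q : Type*) [AddCommGroup Q] :
    ∃ K : ℕ → ZMod (lucas n) × ZMod (lucas n), IsUniversalFibSeq n (-(-1) ^ n) K Q := by
  obtain ⟨K, hK, h0, h1⟩ := IsFibSeq.exists_of_consecutive n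
    ((1, 0) : ZMod (lucas n) × ZMod (lucas n)) (0, 1)
  refine ⟨K, hK, fun i => ?_, ?_, fun k hk hper => ?_⟩
  · have hz : (lucas n : ℤ) • K (i + n) = 0 := by ext <;> simp
    rw [neg_smul, eq_neg_iff_add_eq_zero, hK.add_neg_one_pow_smul, hz]
  · rw [eq_top_iff]
    intro z _
    obtain ⟨s, t, rfl⟩ := zmod_prod_eq_zsmul z
    rw [← h0, ← h1]
    exact add_mem (zsmul_mem (AddSubgroup.subset_closure (Set.mem_range_self n)) s)
      (zsmul_mem (AddSubgroup.subset_closure (Set.mem_range_self (n + 1))) t)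
  · have hz (i : ℕ) : (lucas n : ℤ) • k (i + n) = 0 := by
      rw [← hk.add_neg_one_pow_smul, hper, neg_smul, neg_add_cancel]
    obtain ⟨g, hg0, hg1⟩ := exists_hom_zmod_prod (by simpa using hz 0)
      (by simpa [add_comm] using hz 1)
    refine ⟨g, fun i => ?_⟩
    exact congrFun ((hK.map g).ext_of_consecutive hk n (by simp [h0, hg0]) (by simp [h1, hg1])) i

/-- The analogue of `ℤ[θ] / (√5 f_n) = ℤ / f_n × ℤ / 5 f_n`, with respect to the basis `√5, θ` of
`ℤ[θ]`. -/
theorem exists_universal_fib (n : ℕ) (Q : Type*) [AddCommGroup Q] :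
    ∃ K : ℕ → ZMod (Nat.fib n) × ZMod (5 * Nat.fib n), IsUniversalFibSeq n ((-1) ^ n) K Q := by
  -- `(-1, 2)` makes `2 K (n + 1) - K n` equal to the generator `(1, 0)` of order `f_n`
  obtain ⟨K, hK, h0, h1⟩ := IsFibSeq.exists_of_consecutive n
    ((-1, 2) : ZMod (Nat.fib n) × ZMod (5 * Nat.fib n)) (0, 1)
  refine ⟨K, hK, fun i => ?_, ?_, fun k hk hper => ?_⟩
  · have hz : (fun i => (Nat.fib n : ℤ) • ((2 : ℤ) • K (i + 1) - K i)) = fun _ => 0 := by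
      refine (hK.two_smul_sub.smul _).ext_of_consecutive (fun i => by simp) n ?_ ?_
      · rw [h0, h1]
        ext <;> simp
      · rw [hK n, h0, h1]
        have : (Nat.fib n : ZMod (5 * Nat.fib n)) * 5 = 0 := by
          have := ZMod.natCast_self (5 * Nat.fib n)
          push_cast at this
          exact (mul_comm _ _).trans this
        ext
        · simp
        · change (Nat.fib n : ℤ) • ((2 : ℤ) • ((1 : ZMod (5 * Nat.fib n)) + 2) - 1) = 0
          simp only [zsmul_eq_mul]
          push_cast
          linear_combination this
    rw [← sub_eq_zero, hK.sub_neg_one_pow_smul]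
    exact congrFun hz (i + n)
  · rw [eq_top_iff]
    intro z _
    obtain ⟨s, t, rfl⟩ := zmod_prod_eq_zsmul z
    have h2 : ((1, 0) : ZMod (Nat.fib n) × ZMod (5 * Nat.fib n)) = (2 : ℤ) • K (n + 1) - K n := by
      rw [h0, h1]
      ext <;> simp
    have m0 : K n ∈ AddSubgroup.closure (Set.range K) := AddSubgroup.subset_closure ⟨n, rfl⟩
    have m1 : K (n + 1) ∈ AddSubgroup.closure (Set.range K) := AddSubgroup.subset_closure ⟨_, rfl⟩
    rw [h2, ← h1]
    exact add_mem (zsmul_mem (sub_mem (zsmul_mem m1 2) m0) s) (zsmul_mem m1 t)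
  · have hz (i : ℕ) : (Nat.fib n : ℤ) • ((2 : ℤ) • k (i + n + 1) - k (i + n)) = 0 := by
      rw [← hk.sub_neg_one_pow_smul, hper, sub_self]
    have hz0 := hz 0
    have hz1 := hz 1
    rw [zero_add] at hz0
    rw [add_comm 1 n, hk n] at hz1
    -- `5 θ = √5 θ + 2 √5`, up to the unit `θ ^ n`
    have hz5 : ((5 * Nat.fib n : ℕ) : ℤ) • k (n + 1) = 0 := by
      have : ((5 * Nat.fib n : ℕ) : ℤ) • k (n + 1) =
          (Nat.fib n : ℤ) • ((2 : ℤ) • (k (n + 1) + k n) - k (n + 1)) +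
          (2 : ℤ) • ((Nat.fib n : ℤ) • ((2 : ℤ) • k (n + 1) - k n)) := by
        push_cast
        module
      rw [this, hz0, hz1, smul_zero, add_zero]
    obtain ⟨g, hg0, hg1⟩ := exists_hom_zmod_prod hz0 hz5
    refine ⟨g, fun i => ?_⟩
    refine congrFun ((hK.map g).ext_of_consecutive hk n ?_ (by simp only [h1, hg1])) i
    have h2 : ((-1, 2) : ZMod (Nat.fib n) × ZMod (5 * Nat.fib n)) =
        (2 : ℤ) • ((0, 1) : ZMod (Nat.fib n) × ZMod (5 * Nat.fib n)) - (1, 0) := by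
      ext <;> simp
    simp only [h0]
    rw [h2, map_sub, map_zsmul, hg0, hg1]
    abel

/-! ### The rim of the wheel -/

open scoped Fin.NatCast Fin.CommRing

variable {m : ℕ}

theorem add_one_ne_self (i : Fin (m + 3)) : i + 1 ≠ i := by simp

/-- A rim vertex has two distinct neighbours on the rim, because the rim has at least three
vertices. -/
theorem sub_one_ne_add_one (i : Fin (m + 3)) : i - 1 ≠ i + 1 := by
  intro h
  have h2 : (1 : Fin (m + 3)) + 1 = 0 := by linear_combination -h
  have := congrArg Fin.val h2
  simp [Fin.val_add, Nat.mod_eq_of_lt (show 2 < m + 3 by omega)] at this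

theorem wheelGraph_adj_some {i j : Fin (m + 3)} :
    (wheelGraph (m + 3)).Adj (some i) (some j) ↔ j = i + 1 ∨ j = i - 1 := by
  change (SimpleGraph.cycleGraph (m + 1 + 2)).Adj i j ↔ _
  rw [SimpleGraph.cycleGraph_adj, or_comm]
  refine or_congr ⟨fun h => ?_, fun h => ?_⟩ ⟨fun h => ?_, fun h => ?_⟩
  · linear_combination h
  · linear_combination h
  · linear_combination -h
  · linear_combination -h

theorem adj_add_one (i : Fin (m + 3)) : (wheelGraph (m + 3)).Adj (some i) (some (i + 1)) :=
  wheelGraph_adj_some.2 (Or.inl rfl)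

theorem degree_some (i : Fin (m + 3)) : (wheelGraph (m + 3)).degree (some i) = 3 := by
  have : (wheelGraph (m + 3)).neighborFinset (some i) = {none, some (i + 1), some (i - 1)} := by
    ext v
    rcases v with _ | j
    · exact iff_of_true ((SimpleGraph.mem_neighborFinset _ _ _).2
        (show (wheelGraph (m + 3)).Adj (some i) none from trivial)) (by simp)
    · simp [wheelGraph_adj_some]
  rw [← SimpleGraph.card_neighborFinset_eq_degree, this, Finset.card_eq_three]
  exact ⟨_, _, _, by simp, by simp, by simpa using (sub_one_ne_add_one i).symm, rfl⟩

/-- The sign of the rim edge from `i` to `i + 1`. -/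
def rimSign (φ : Signature (wheelGraph (m + 3))) (i : Fin (m + 3)) : ℤˣ :=
  φ ⟨s(some i, some (i + 1)), adj_add_one i⟩

/-- The sign of the rim: the product of the signs of its edges. -/
def rimProd (φ : Signature (wheelGraph (m + 3))) : ℤˣ := ∏ i, rimSign φ i

/-- The vertex `i` of the rim as a nonsink vertex. -/
def rimVertex (i : Fin (m + 3)) : {v : Option (Fin (m + 3)) // v ≠ none} :=
  ⟨some i, Option.some_ne_none i⟩

theorem rimVertex_injective : Function.Injective (rimVertex (m := m)) := fun i j h => by
  simpa [rimVertex] using h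

theorem exists_rimVertex (v : {v : Option (Fin (m + 3)) // v ≠ none}) : ∃ i, v = rimVertex i := by
  rcases v with ⟨_ | i, h⟩
  · exact absurd rfl h
  · exact ⟨i, rfl⟩

/-- The sign of the path `0, 1, …, j` that runs along the rim, possibly several times around. -/
def pathSign (φ : Signature (wheelGraph (m + 3))) (j : ℕ) : ℤˣ :=
  ∏ k ∈ Finset.range j, rimSign φ (k : Fin (m + 3))

theorem pathSign_succ (φ : Signature (wheelGraph (m + 3))) (j : ℕ) :
    pathSign φ (j + 1) = pathSign φ j * rimSign φ (j : Fin (m + 3)) :=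
  Finset.prod_range_succ _ _

theorem pathSign_add (φ : Signature (wheelGraph (m + 3))) (j : ℕ) :
    pathSign φ (j + (m + 3)) = rimProd φ * pathSign φ j := by
  induction j with
  | zero =>
    rw [zero_add, pathSign, ← Fin.prod_univ_eq_prod_range, rimProd]
    simp [pathSign]
  | succ j ih =>
    rw [add_right_comm, pathSign_succ, pathSign_succ, ih, mul_assoc]
    congr 3
    push_cast
    have : ((m + 3 : ℕ) : Fin (m + 3)) = 0 := by simp
    push_cast at this
    rw [this, add_zero]

/-! ### The critical group as a universal Fibonacci sequence -/

section CriticalGroup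

variable (φ : Signature (wheelGraph (m + 3)))

theorem laplacian_self (i : Fin (m + 3)) : laplacian φ (some i) (some i) = 3 := by
  simp [laplacian, degree_some]

theorem laplacian_add_one (i : Fin (m + 3)) :
    laplacian φ (some i) (some (i + 1)) = -(rimSign φ i : ℤ) := by
  simp [laplacian, rimSign, adj_add_one]

theorem laplacian_add_one_left (i : Fin (m + 3)) :
    laplacian φ (some (i + 1)) (some i) = -(rimSign φ i : ℤ) := by
  have h : s(some (i + 1), some i) = s(some i, some (i + 1)) := Sym2.eq_swap
  simp [laplacian, rimSign, (adj_add_one i).symm, h]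

theorem laplacian_eq_zero {i j : Fin (m + 3)} (h0 : i ≠ j) (h1 : j ≠ i + 1) (h2 : j ≠ i - 1) :
    laplacian φ (some i) (some j) = 0 := by
  simp [laplacian, h0, wheelGraph_adj_some, h1, h2]

/-- The relation imposed by the column of `i + 1` of the reduced Laplacian. -/
theorem sum_reducedLaplacian_smul {A : Type*} [AddCommGroup A]
    (c : {v : Option (Fin (m + 3)) // v ≠ none} → A) (i : Fin (m + 3)) :
    ∑ v, reducedLaplacian φ none v (rimVertex (i + 1)) • c v =
      (3 : ℤ) • c (rimVertex (i + 1)) - (rimSign φ i : ℤ) • c (rimVertex i) -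
        (rimSign φ (i + 1) : ℤ) • c (rimVertex (i + 1 + 1)) := by
  have h01 : i ≠ i + 1 := (add_one_ne_self i).symm
  have h12 : i + 1 ≠ i + 1 + 1 := (add_one_ne_self (i + 1)).symm
  have h02 : i ≠ i + 1 + 1 := by
    have := sub_one_ne_add_one (i + 1)
    rwa [add_sub_cancel_right] at this
  rw [← Finset.sum_subset (Finset.subset_univ {rimVertex i, rimVertex (i + 1),
      rimVertex (i + 1 + 1)}), Finset.sum_insert, Finset.sum_insert, Finset.sum_singleton]
  · simp only [reducedLaplacian, rimVertex, Matrix.submatrix_apply, laplacian_self,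
      laplacian_add_one, laplacian_add_one_left]
    module
  · rwa [Finset.mem_singleton, rimVertex_injective.eq_iff]
  · rw [Finset.mem_insert, Finset.mem_singleton, rimVertex_injective.eq_iff,
      rimVertex_injective.eq_iff, not_or]
    exact ⟨h01, h02⟩
  · intro v _ hv
    obtain ⟨j, rfl⟩ := exists_rimVertex v
    simp only [Finset.mem_insert, Finset.mem_singleton, rimVertex_injective.eq_iff, not_or] at hv
    simp only [reducedLaplacian, rimVertex, Matrix.submatrix_apply]
    rw [laplacian_eq_zero φ hv.2.1, zero_smul]
    · exact fun h => hv.1 (add_right_cancel h).symm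
    · exact fun h => hv.2.2 (by rw [h, sub_add_cancel])

/-- The class of the rim vertex `i` in the critical group. -/
def vertexClass (i : Fin (m + 3)) : CriticalGroup φ none :=
  Submodule.Quotient.mk (Pi.single (rimVertex i) 1)

theorem vertexClass_relation (i : Fin (m + 3)) :
    (3 : ℤ) • vertexClass φ (i + 1) - (rimSign φ i : ℤ) • vertexClass φ i -
      (rimSign φ (i + 1) : ℤ) • vertexClass φ (i + 1 + 1) = 0 := by
  have h := sum_reducedLaplacian_smul φ
    (fun v => (Submodule.Quotient.mk (Pi.single v 1) : CriticalGroup φ none)) i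
  rw [vertexClass, vertexClass, vertexClass, ← h]
  simp only [← Submodule.Quotient.mk_smul]
  have hs : ∑ v, (Submodule.Quotient.mk (reducedLaplacian φ none v (rimVertex (i + 1)) •
      Pi.single v (1 : ℤ)) : CriticalGroup φ none) =
      Submodule.Quotient.mk (∑ v, reducedLaplacian φ none v (rimVertex (i + 1)) •
        Pi.single v (1 : ℤ)) :=
    (map_sum (Submodule.mkQ _) _ _).symm
  rw [hs, Submodule.Quotient.mk_eq_zero]
  refine ⟨Pi.single (rimVertex (i + 1)) 1, ?_⟩
  ext v
  simp [Finset.sum_apply, Pi.single_apply]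

theorem criticalGroup_hom_ext {A : Type*} [AddCommGroup A] {f g : CriticalGroup φ none →+ A}
    (h : ∀ i, f (vertexClass φ i) = g (vertexClass φ i)) : f = g := by
  have : f.toIntLinearMap = g.toIntLinearMap := by
    refine Submodule.linearMap_qext _ (LinearMap.pi_ext' fun v => LinearMap.ext_ring ?_)
    obtain ⟨i, rfl⟩ := exists_rimVertex v
    exact h i
  exact AddMonoidHom.ext fun x => congrArg (fun l => l x) this

/-- The critical group is presented by the rim vertices and the relations at them. -/
theorem exists_criticalGroup_hom {A : Type*} [AddCommGroup A] (c : Fin (m + 3) → A)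
    (hc : ∀ i, (3 : ℤ) • c (i + 1) - (rimSign φ i : ℤ) • c i -
      (rimSign φ (i + 1) : ℤ) • c (i + 1 + 1) = 0) :
    ∃ f : CriticalGroup φ none →+ A, ∀ i, f (vertexClass φ i) = c i := by
  let c' : {v : Option (Fin (m + 3)) // v ≠ none} → A := fun v => c (v.1.get (by
    simpa [Option.isSome_iff_ne_none] using v.2))
  let l := Fintype.linearCombination ℤ c'
  refine ⟨(Submodule.liftQ (LinearMap.range (reducedLaplacian φ none).mulVecLin) l
    ?_).toAddMonoidHom, fun i => ?_⟩
  · rw [LinearMap.range_le_ker_iff]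
    refine LinearMap.pi_ext' fun v => LinearMap.ext_ring ?_
    obtain ⟨i, rfl⟩ := exists_rimVertex v
    obtain ⟨i, rfl⟩ : ∃ j, i = j + 1 := ⟨i - 1, by simp⟩
    have h := sum_reducedLaplacian_smul φ c' i
    have h' : ∑ v, reducedLaplacian φ none v (rimVertex (i + 1)) • c' v = 0 := h.trans (hc i)
    simpa [l, Fintype.linearCombination_apply] using h'
  · change l (Pi.single (rimVertex i) 1) = c i
    simp [l, c', rimVertex]

/-- The classes of the rim vertices, signed so that the rim edges become positive, are the
even-indexed terms of a Fibonacci sequence. The sequence runs around the rim indefinitely, and each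
turn multiplies it by the sign of the rim. -/
theorem exists_fibSeq_criticalGroup :
    ∃ k : ℕ → CriticalGroup φ none, IsFibSeq k ∧
      (∀ i, k (i + 2 * (m + 3)) = (rimProd φ : ℤ) • k i) ∧
      ∀ j : ℕ, k (2 * j) = (pathSign φ j : ℤ) • vertexClass φ (j : Fin (m + 3)) := by
  set h : ℕ → CriticalGroup φ none :=
    fun j => (pathSign φ j : ℤ) • vertexClass φ (j : Fin (m + 3)) with hdef
  have hrec (j : ℕ) : h (j + 2) = (3 : ℤ) • h (j + 1) - h j := by
    have e : h (j + 2) - ((3 : ℤ) • h (j + 1) - h j) = 0 := by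
      have r := vertexClass_relation φ (j : Fin (m + 3))
      have s0 : (rimSign φ (j : Fin (m + 3)) : ℤ) * rimSign φ (j : Fin (m + 3)) = 1 := by
        rw [← Units.val_mul, Int.units_mul_self, Units.val_one]
      have r' := congrArg (fun x => (-(pathSign φ (j + 1) : ℤ)) • x) r
      simp only [smul_zero] at r'
      rw [← r']
      simp only [hdef, pathSign_succ, Nat.cast_add, Nat.cast_one, Units.val_mul,
        show ((j + 2 : ℕ) : Fin (m + 3)) = j + 1 + 1 by push_cast; ring,
        show j + 2 = j + 1 + 1 by ring]
      match_scalars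
      · ring
      · ring
      · linear_combination (pathSign φ j : ℤ) * (-s0)
    exact sub_eq_zero.1 e
  have hper (j : ℕ) : h (j + (m + 3)) = (rimProd φ : ℤ) • h j := by
    simp only [hdef, pathSign_add, Units.val_mul, mul_smul]
    have : ((j + (m + 3) : ℕ) : Fin (m + 3)) = j := by
      have := Fin.natCast_self (m + 3)
      rw [Nat.cast_add, this, add_zero]
    rw [this]
  -- consecutive classes are two steps apart, like `θ ^ (2 j)` and `θ ^ (2 (j + 1))`, and the odd
  -- terms are forced to be the differences
  obtain ⟨k, hk, k0, k1⟩ := IsFibSeq.exists_of_consecutive 0 (h 0) (h 1 - h 0)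
  have hkh (j : ℕ) : k (2 * j) = h j ∧ k (2 * j + 1) = h (j + 1) - h j := by
    induction j with
    | zero => exact ⟨k0, k1⟩
    | succ j ih =>
      have e : k (2 * j + 2) = h (j + 1) := by rw [hk, ih.1, ih.2]; abel
      refine ⟨e, ?_⟩
      rw [show 2 * (j + 1) + 1 = 2 * j + 1 + 2 by ring, hk, e, ih.2, hrec j]
      module
  refine ⟨k, hk, fun i => ?_, fun j => (hkh j).1⟩
  refine congrFun ((hk.shift (2 * (m + 3))).ext_of_consecutive (hk.smul _) 0 ?_ ?_) i
  · rw [zero_add, (hkh (m + 3)).1, k0, ← hper, zero_add]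
  · rw [zero_add, add_comm 1, (hkh (m + 3)).2, k1, smul_sub, ← hper, ← hper, zero_add,
      add_comm 1 (m + 3)]

/-- The critical group is determined by the universal property of its Fibonacci sequence. -/
theorem nonempty_criticalGroup_equiv {G : Type*} [AddCommGroup G] {K : ℕ → G}
    (hK : IsUniversalFibSeq (m + 3) (rimProd φ) K (CriticalGroup φ none)) :
    Nonempty (CriticalGroup φ none ≃+ G) := by
  obtain ⟨k, hk, kper, hkv⟩ := exists_fibSeq_criticalGroup φ
  obtain ⟨g, hg⟩ := hK.exists_hom k hk kper
  have hsq (a : ℤˣ) : (a : ℤ) * a = 1 := by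
    rw [← Units.val_mul, Int.units_mul_self, Units.val_one]
  set c : Fin (m + 3) → G := fun i => (pathSign φ i : ℤ) • K (2 * i) with hcdef
  have hper : Function.Periodic (fun j : ℕ => (pathSign φ j : ℤ) • K (2 * j)) (m + 3) := by
    intro j
    simp only [pathSign_add, Units.val_mul]
    rw [mul_add, hK.period, smul_smul, mul_right_comm, hsq, one_mul]
  have hc (j : ℕ) : c (j : Fin (m + 3)) = (pathSign φ j : ℤ) • K (2 * j) :=
    hper.map_mod_nat j
  obtain ⟨f, hf⟩ := exists_criticalGroup_hom φ c fun i => by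
    obtain ⟨j, rfl⟩ : ∃ j : ℕ, i = j := ⟨i, by simp⟩
    have c1 := hc (j + 1)
    have c2 := hc (j + 2)
    have e1 : ((j + 1 : ℕ) : Fin (m + 3)) = j + 1 := by push_cast; rfl
    have e2 : ((j + 2 : ℕ) : Fin (m + 3)) = j + 1 + 1 := by push_cast; ring
    rw [e1, pathSign_succ] at c1
    rw [e2, show j + 2 = j + 1 + 1 by ring, pathSign_succ, pathSign_succ, e1] at c2
    rw [hc, c1, c2, show 2 * (j + 1 + 1) = 2 * j + 2 + 2 by ring,
      show 2 * (j + 1) = 2 * j + 2 by ring, hK.isFibSeq (2 * j + 2),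
      show 2 * j + 2 + 1 = 2 * j + 1 + 2 by ring, hK.isFibSeq (2 * j + 1), hK.isFibSeq (2 * j)]
    have s0 := hsq (rimSign φ (j : Fin (m + 3)))
    have s1 := hsq (rimSign φ ((j : Fin (m + 3)) + 1))
    push_cast
    match_scalars
    · linear_combination (-3 : ℤ) * (pathSign φ j : ℤ) * rimSign φ (j : Fin (m + 3)) * s1
    · linear_combination (-2 : ℤ) * (pathSign φ j : ℤ) * rimSign φ (j : Fin (m + 3)) * s1
  have hfk : (fun i => f (k i)) = K := by
    have h0 (j : ℕ) : f (k (2 * j)) = K (2 * j) := by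
      rw [hkv, map_zsmul, hf, hc, smul_smul, hsq, one_smul]
    refine (hk.map f).ext_of_consecutive hK.isFibSeq 0 (h0 0) ?_
    have := h0 1
    rw [show 2 * 1 = 0 + 2 by rfl, hk, hK.isFibSeq, map_add, h0 0] at this
    exact add_right_cancel this
  refine ⟨AddMonoidHom.toAddEquiv f g ?_ ?_⟩
  · refine criticalGroup_hom_ext φ fun i => ?_
    simp only [AddMonoidHom.comp_apply, hf, hcdef, map_zsmul, hg, hkv, smul_smul, hsq, one_smul,
      Fin.cast_val_eq_self, AddMonoidHom.id_apply]
  · refine AddMonoidHom.eq_of_eqOn_dense hK.closure_range ?_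
    rintro _ ⟨i, rfl⟩
    simp only [AddMonoidHom.comp_apply, hg, AddMonoidHom.id_apply]
    exact congrFun hfk i

end CriticalGroup

/-! ### Balance of the rim -/

/-- Switching preserves the product of the signs along a closed walk. -/
theorem SwitchingEquivalent.prod_closedWalk_eq {V : Type*} [DecidableEq V] {G : SimpleGraph V}
    {φ ψ : Signature G} (h : SwitchingEquivalent φ ψ) {n : ℕ} [NeZero n] (w : Fin n → V)
    (hw : ∀ i, G.Adj (w i) (w (i + 1))) :
    ∏ i, φ ⟨s(w i, w (i + 1)), hw i⟩ = ∏ i, ψ ⟨s(w i, w (i + 1)), hw i⟩ := by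
  induction h with
  | refl => rfl
  | tail _ h ih =>
    obtain ⟨v, rfl⟩ := h
    rw [ih]
    rename_i α _
    -- each position of the closed walk is an end of two of its edges, so its signs cancel
    let χ : Fin n → ℤˣ := fun i => if v = w i then -1 else 1
    have key (i : Fin n) : switch α v ⟨s(w i, w (i + 1)), hw i⟩ =
        χ i * χ (i + 1) * α ⟨s(w i, w (i + 1)), hw i⟩ := by
      have hne : w i ≠ w (i + 1) := (hw i).ne
      by_cases h0 : v = w i
      · have h1 : v ≠ w (i + 1) := fun h => hne (h0.symm.trans h)
        simp [switch, χ, h0, hne]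
      · by_cases h1 : v = w (i + 1)
        · simp [switch, χ, h1, hne.symm]
        · simp [switch, χ, h0, h1]
    simp only [key, Finset.prod_mul_distrib]
    rw [show ∏ i, χ (i + 1) = ∏ i, χ i from Equiv.prod_comp (Equiv.addRight 1) χ,
      Int.units_mul_self, one_mul]

/-- Switching all vertices where the potential `η` is `-1` makes every edge positive. -/
theorem isBalanced_of_potential {V : Type*} [DecidableEq V] [Fintype V] {G : SimpleGraph V}
    (φ : Signature G) (η : V → ℤˣ)
    (h : ∀ a b (hab : G.Adj a b), φ ⟨s(a, b), hab⟩ = η a * η b) : IsBalanced φ := by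
  suffices key : ∀ (S : Finset V) (φ : Signature G),
      (∀ a b (hab : G.Adj a b), φ ⟨s(a, b), hab⟩ =
        (if a ∈ S then -1 else 1) * (if b ∈ S then -1 else 1)) → IsBalanced φ by
    refine key (Finset.univ.filter fun v => η v = -1) φ fun a b hab => ?_
    rw [h a b hab]
    rcases Int.units_eq_one_or (η a) with ha | ha <;>
      rcases Int.units_eq_one_or (η b) with hb | hb <;> simp [ha, hb]
  intro S
  induction S using Finset.induction_on with
  | empty =>
    intro φ h
    have : φ = fun _ => 1 := by
      funext ⟨e, he⟩
      induction e using Sym2.ind with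
      | _ a b => simpa using h a b he
    rw [this]
    exact Relation.ReflTransGen.refl
  | insert v S hv ih =>
    intro φ h
    refine Relation.ReflTransGen.head ⟨v, rfl⟩ (ih (switch φ v) fun a b hab => ?_)
    have hne : a ≠ b := hab.ne
    simp only [switch, h a b hab, Sym2.mem_iff, Finset.mem_insert]
    by_cases ha : a = v
    · subst ha
      by_cases hb : b ∈ S <;> simp [hv, hb, hne.symm]
    · by_cases hb : b = v
      · subst hb
        by_cases ha : a ∈ S <;> simp [hv, ha, hne]
      · simp [ha, hb, Ne.symm ha, Ne.symm hb]

theorem isBalanced_deleteVertex_iff (φ : Signature (wheelGraph (m + 3))) :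
    IsBalanced (deleteVertex φ none) ↔ rimProd φ = 1 := by
  constructor
  · intro h
    have := h.prod_closedWalk_eq
      (w := fun i : Fin (m + 3) => (⟨some i, Option.some_ne_none i⟩ : {v | v ≠ none}))
      adj_add_one
    rw [Finset.prod_const_one] at this
    exact this
  · intro h
    have hper : Function.Periodic (pathSign φ) (m + 3) := fun j => by
      rw [pathSign_add, h, one_mul]
    have key (i : Fin (m + 3)) :
        rimSign φ i = pathSign φ i * pathSign φ ((i + 1 : Fin (m + 3)) : ℕ) := by
      have e : pathSign φ ((i + 1 : Fin (m + 3)) : ℕ) = pathSign φ (i + 1) := by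
        rw [Fin.val_add, ← hper.map_mod_nat (i + 1)]
        simp
      rw [e, pathSign_succ, ← mul_assoc, Int.units_mul_self, one_mul, Fin.cast_val_eq_self]
    refine isBalanced_of_potential _ (fun v => pathSign φ (v.1.elim 0 Fin.val)) ?_
    rintro ⟨_ | a, ha⟩ ⟨_ | b, hb⟩ hab
    · exact absurd rfl ha
    · exact absurd rfl ha
    · exact absurd rfl hb
    have hab' : (wheelGraph (m + 3)).Adj (some a) (some b) := hab
    change φ ⟨s(some a, some b), hab'⟩ = pathSign φ a * pathSign φ b
    rcases wheelGraph_adj_some.1 hab' with rfl | rfl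
    · exact key a
    · obtain ⟨c, rfl⟩ : ∃ c, a = c + 1 := ⟨a - 1, by simp⟩
      have e : (⟨s(some (c + 1), some (c + 1 - 1)), hab'⟩ : (wheelGraph (m + 3)).edgeSet) =
          ⟨s(some c, some (c + 1)), adj_add_one c⟩ := by
        simp [Sym2.eq_swap]
      rw [e, add_sub_cancel_right, mul_comm]
      exact key c

theorem exists_rimProd_eq_one : ∃ φ : Signature (wheelGraph (m + 3)), rimProd φ = 1 :=
  ⟨fun _ => 1, by simp [rimProd, rimSign]⟩

theorem exists_rimProd_eq_neg_one : ∃ φ : Signature (wheelGraph (m + 3)), rimProd φ = -1 := by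
  refine ⟨fun e => if e.1 = s(some 0, some 1) then -1 else 1, ?_⟩
  have h (i : Fin (m + 3)) : s(some i, some (i + 1)) = s(some (0 : Fin (m + 3)), some 1) ↔
      i = 0 := by
    constructor
    · intro h
      rcases Sym2.eq_iff.1 h with ⟨h, -⟩ | ⟨h0, h1⟩
      · simpa using h
      · simp only [Option.some.injEq] at h0 h1
        subst h0
        exact absurd h1.symm (by simpa using sub_one_ne_add_one (1 : Fin (m + 3)))
    · rintro rfl
      simp
  simp [rimProd, rimSign, h, Finset.prod_ite_eq']

/-! ### Critical groups of signed wheels -/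

theorem nonempty_equiv_lucas (φ : Signature (wheelGraph (m + 3)))
    (h : (rimProd φ : ℤ) = -(-1) ^ (m + 3)) :
    Nonempty (CriticalGroup φ none ≃+ ZMod (lucas (m + 3)) × ZMod (lucas (m + 3))) := by
  obtain ⟨K, hK⟩ := exists_universal_lucas (m + 3) (CriticalGroup φ none)
  rw [← h] at hK
  exact nonempty_criticalGroup_equiv φ hK

theorem nonempty_equiv_fib (φ : Signature (wheelGraph (m + 3)))
    (h : (rimProd φ : ℤ) = (-1) ^ (m + 3)) :
    Nonempty (CriticalGroup φ none ≃+
      ZMod (Nat.fib (m + 3)) × ZMod (5 * Nat.fib (m + 3))) := by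
  obtain ⟨K, hK⟩ := exists_universal_fib (m + 3) (CriticalGroup φ none)
  rw [← h] at hK
  exact nonempty_criticalGroup_equiv φ hK

theorem exists_rimProd_eq (ε : ℤˣ) : ∃ φ : Signature (wheelGraph (m + 3)), rimProd φ = ε := by
  rcases Int.units_eq_one_or ε with rfl | rfl
  · exact exists_rimProd_eq_one
  · exact exists_rimProd_eq_neg_one

end SignedGraph

theorem mainTheorem1 (n : ℕ) (hn : 3 ≤ n) :
    (∀ φ : SignedGraph.Signature (SignedGraph.wheelGraph n),
      (Odd n → ¬ SignedGraph.IsBalanced (SignedGraph.deleteVertex φ none) →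
        Nonempty (SignedGraph.CriticalGroup φ none ≃+
          ZMod (Nat.fib n) × ZMod (5 * Nat.fib n))) ∧
      (Even n → ¬ SignedGraph.IsBalanced (SignedGraph.deleteVertex φ none) →
        Nonempty (SignedGraph.CriticalGroup φ none ≃+
          ZMod (SignedGraph.lucas n) × ZMod (SignedGraph.lucas n))) ∧
      (Odd n → SignedGraph.IsBalanced (SignedGraph.deleteVertex φ none) →
        Nonempty (SignedGraph.CriticalGroup φ none ≃+
          ZMod (SignedGraph.lucas n) × ZMod (SignedGraph.lucas n))) ∧
      (Even n → SignedGraph.IsBalanced (SignedGraph.deleteVertex φ none) →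
        Nonempty (SignedGraph.CriticalGroup φ none ≃+
          ZMod (Nat.fib n) × ZMod (5 * Nat.fib n)))) ∧
    (∀ (A : Type*) [AddCommGroup A],
      (∃ φ : SignedGraph.Signature (SignedGraph.wheelGraph n),
        Nonempty (SignedGraph.CriticalGroup φ none ≃+ A)) ↔
      (Nonempty (A ≃+ ZMod (Nat.fib n) × ZMod (5 * Nat.fib n)) ∨
        Nonempty (A ≃+ ZMod (SignedGraph.lucas n) × ZMod (SignedGraph.lucas n)))) := by
  obtain ⟨m, rfl⟩ : ∃ m, n = m + 3 := ⟨n - 3, by omega⟩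
  have unbal (φ : SignedGraph.Signature (SignedGraph.wheelGraph (m + 3)))
      (h : ¬ SignedGraph.IsBalanced (SignedGraph.deleteVertex φ none)) :
      SignedGraph.rimProd φ = -1 :=
    (Int.units_eq_one_or _).resolve_left fun h1 =>
      h ((SignedGraph.isBalanced_deleteVertex_iff φ).2 h1)
  refine ⟨fun φ => ⟨fun hn hb => ?_, fun hn hb => ?_, fun hn hb => ?_, fun hn hb => ?_⟩,
    fun A _ => ⟨?_, ?_⟩⟩
  · exact SignedGraph.nonempty_equiv_fib φ (by simp [unbal φ hb, hn.neg_one_pow])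
  · exact SignedGraph.nonempty_equiv_lucas φ (by simp [unbal φ hb, hn.neg_one_pow])
  · exact SignedGraph.nonempty_equiv_lucas φ
      (by simp [(SignedGraph.isBalanced_deleteVertex_iff φ).1 hb, hn.neg_one_pow])
  · exact SignedGraph.nonempty_equiv_fib φ
      (by simp [(SignedGraph.isBalanced_deleteVertex_iff φ).1 hb, hn.neg_one_pow])
  · rintro ⟨φ, ⟨e⟩⟩
    by_cases h : SignedGraph.rimProd φ = (-1) ^ (m + 3)
    · obtain ⟨e'⟩ := SignedGraph.nonempty_equiv_fib φ (by rw [h]; simp)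
      exact Or.inl ⟨e.symm.trans e'⟩
    · obtain ⟨e'⟩ := SignedGraph.nonempty_equiv_lucas φ
        (by rw [Int.units_ne_iff_eq_neg.1 h]; simp)
      exact Or.inr ⟨e.symm.trans e'⟩
  · rintro (⟨⟨e⟩⟩ | ⟨⟨e⟩⟩)
    · obtain ⟨φ, h⟩ := SignedGraph.exists_rimProd_eq (m := m) ((-1) ^ (m + 3))
      obtain ⟨e'⟩ := SignedGraph.nonempty_equiv_fib φ (by rw [h]; simp)
      exact ⟨φ, ⟨e'.trans e.symm⟩⟩
    · obtain ⟨φ, h⟩ := SignedGraph.exists_rimProd_eq (m := m) (-(-1) ^ (m + 3))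
      obtain ⟨e'⟩ := SignedGraph.nonempty_equiv_lucas φ (by rw [h]; simp)
      exact ⟨φ, ⟨e'.trans e.symm⟩⟩
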